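/- An inverse monoid is a monoid $S$ with an involution $x\mapsto x^{-1}$ (so $(x^{-1})^{-1}=x$, $(xy)^{-1}=y^{-1}x^{-1}$) satisfying $xx^{-1}x=x$ and $xx^{-1}yy^{-1}=yy^{-1}xx^{-1}$; $E(S)$ denotes its semilattice of idempotents. A (two-sided) restriction monoid is an algebra $(T;\cdot,{}^*,{}^+,1)$ of type $(2,1,1,0)$ such that $(T;\cdot,1)$ is a monoid and $xx^*=x$, $x^*y^*=y^*x^*$, $(xy^*)^*=x^*y^*$, $x^*y=y(xy)^*$, $x^+x=x$, $x^+y^+=y^+x^+$, $(x^+y)^+=x^+y^+$, $xy^+=(xy)^+x$, $(x^+)^*=x^+$, $(x^*)^+=x^*$ hold. Let $S$ be an inverse monoid. (1) Let $\mathcal{FR}_s(S)$ be the restriction monoid generated by symbols $\lfloor s\rfloor$, $s\in S$, subject to the relations $\lfloor 1\rfloor=1$, $\lfloor s\rfloor\lfloor t\rfloor=\lfloor s\rfloor^+\lfloor st\rfloor$ and $\lfloor s\rfloor\lfloor t\rfloor=\lfloor st\rfloor\lfloor t\rfloor^*$ for all $s,t\in S$ (the free restriction monoid over $S$ with respect to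 strong premorphisms). (2) Let $S^{pr}$ be the generalized prefix expansion of $S$: the inverse monoid of pairs $(A,s)$, where $s\in S$ and $A\subseteq S$ is a finite set with $s,ss^{-1}\in A$ and $aa^{-1}=ss^{-1}$ for all $a\in A$, with operations $(A,s)(B,t)=((st)(st)^{-1}A\cup sB,\ st)$, $(A,s)^{-1}=(s^{-1}A,s^{-1})$ and identity $(\{1\},1)$. For $s\in S$ put $[s]=(\{ss^{-1},s\},s)\in S^{pr}$. (3) For $s\in S$ let $\varphi_s$ be the partial bijection of $E(S^{pr})$ with domain $\{e: e\le [s]^{-1}[s]\}$ and range $\{e: e\le [s][s]^{-1}\}$, given by $\varphi_s(e)=[s]e[s]^{-1}$. The partial action product determined by $s\mapsto\varphi_s$ is the restriction monoid $$\mathcal M(S,E(S^{pr}))=\{(e,s)\in E(S^{pr})\times S : e\in\mathrm{ran}(\varphi_s)\}$$ with operations $$(e,s)(f,t)=(\varphi_s(\varphi_s^{-1}(e)\wedge f),\,st),\qquad (e,s)^*=(\varphi_s^{-1}(e),1),\qquad (e,s)^+=(e,1)$$ and with identity $(1,1)$. Then $\mathcal{FR}_s(S)$ is isomorphic, as a restriction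 monoid, to $\mathcal M(S,E(S^{pr}))$ (which is therefore a concrete model of $\mathcal{FR}_s(S)$), by an isomorphism sending $\lfloor s\rfloor$ to $([s][s]^{-1},s)$ for every $s\in S$. -/

import Mathlib

universe u v

/-! ## Restriction monoids -/

/-- A (two-sided) restriction monoid: an algebra `(S; *, rstar, rplus, 1)` of type `(2,1,1,0)`,
where `rstar x` is `x^*` and `rplus x` is `x^+`. -/
class RestrictionMonoid (S : Type u) extends Monoid S where
  rstar : S → S
  rplus : S → S
  mul_rstar_self : ∀ x : S, x * rstar x = x
  rstar_comm : ∀ x y : S, rstar x * rstar y = rstar y * rstar x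
  rstar_mul_rstar : ∀ x y : S, rstar (x * rstar y) = rstar x * rstar y
  rstar_mul : ∀ x y : S, rstar x * y = y * rstar (x * y)
  rplus_mul_self : ∀ x : S, rplus x * x = x
  rplus_comm : ∀ x y : S, rplus x * rplus y = rplus y * rplus x
  rplus_rplus_mul : ∀ x y : S, rplus (rplus x * y) = rplus x * rplus y
  mul_rplus : ∀ x y : S, x * rplus y = rplus (x * y) * x
  rstar_rplus : ∀ x : S, rstar (rplus x) = rplus x
  rplus_rstar : ∀ x : S, rplus (rstar x) = rstar x

namespace RestrictionMonoid

/-- The projections: the elements of the form `x^*` (equivalently, of the form `x^+`). -/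
def IsProjection {S : Type u} [RestrictionMonoid S] (e : S) : Prop := ∃ x : S, rstar x = e

/-- The natural partial order: `a ≤ b` iff `a = e b` for some projection `e`. -/
def NatLE {S : Type u} [RestrictionMonoid S] (a b : S) : Prop :=
  ∃ e : S, IsProjection e ∧ a = e * b

/-- Isomorphisms of restriction monoids: bijections preserving all operations
(the identity element is preserved automatically). -/
structure Iso (S : Type u) (T : Type v) [RestrictionMonoid S] [RestrictionMonoid T]
    extends S ≃* T where
  map_rstar : ∀ x : S, toFun (rstar x) = rstar (toFun x)
  map_rplus : ∀ x : S, toFun (rplus x) = rplus (toFun x)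

end RestrictionMonoid

/-- Premorphisms from a monoid to a restriction monoid. -/
structure IsPremorphism {M : Type u} {T : Type v} [Monoid M] [RestrictionMonoid T]
    (φ : M → T) : Prop where
  map_one : φ 1 = 1
  map_mul_le : ∀ m n : M, RestrictionMonoid.NatLE (φ m * φ n) (φ (m * n))

/-! ## Restriction monoids given by generators and relations -/

/-- Terms of type `(2,1,1,0)` over a set `X` of generators. -/
inductive RTerm (X : Type u) : Type u
  | gen : X → RTerm X
  | one : RTerm X
  | mul : RTerm X → RTerm X → RTerm X
  | star : RTerm X → RTerm X
  | plus : RTerm X → RTerm X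

/-- The least `(2,1,1,0)`-congruence on terms that contains the relations `R` and all instances of
the axioms of restriction monoids. -/
inductive RTerm.Cong {X : Type u} (R : RTerm X → RTerm X → Prop) : RTerm X → RTerm X → Prop
  | rel {a b : RTerm X} : R a b → Cong R a b
  | refl (a : RTerm X) : Cong R a a
  | symm {a b : RTerm X} : Cong R a b → Cong R b a
  | trans {a b c : RTerm X} : Cong R a b → Cong R b c → Cong R a c
  | mul_congr {a b c d : RTerm X} : Cong R a b → Cong R c d → Cong R (mul a c) (mul b d)
  | star_congr {a b : RTerm X} : Cong R a b → Cong R (star a) (star b)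
  | plus_congr {a b : RTerm X} : Cong R a b → Cong R (plus a) (plus b)
  | mul_assoc (a b c : RTerm X) : Cong R (mul (mul a b) c) (mul a (mul b c))
  | one_mul (a : RTerm X) : Cong R (mul one a) a
  | mul_one (a : RTerm X) : Cong R (mul a one) a
  | mul_star_self (a : RTerm X) : Cong R (mul a (star a)) a
  | star_comm (a b : RTerm X) : Cong R (mul (star a) (star b)) (mul (star b) (star a))
  | star_mul_star (a b : RTerm X) : Cong R (star (mul a (star b))) (mul (star a) (star b))
  | star_mul (a b : RTerm X) : Cong R (mul (star a) b) (mul b (star (mul a b)))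
  | plus_mul_self (a : RTerm X) : Cong R (mul (plus a) a) a
  | plus_comm (a b : RTerm X) : Cong R (mul (plus a) (plus b)) (mul (plus b) (plus a))
  | plus_plus_mul (a b : RTerm X) : Cong R (plus (mul (plus a) b)) (mul (plus a) (plus b))
  | mul_plus (a b : RTerm X) : Cong R (mul a (plus b)) (mul (plus (mul a b)) a)
  | star_plus (a : RTerm X) : Cong R (star (plus a)) (plus a)
  | plus_star (a : RTerm X) : Cong R (plus (star a)) (star a)

/-- The congruence `RTerm.Cong R` as a setoid. -/
def RTerm.congSetoid {X : Type u} (R : RTerm X → RTerm X → Prop) : Setoid (RTerm X) :=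
  ⟨RTerm.Cong R, RTerm.Cong.refl, RTerm.Cong.symm, RTerm.Cong.trans⟩

/-- The restriction monoid generated by `X` subject to the defining relations `R`. -/
def PresentedRestrictionMonoid {X : Type u} (R : RTerm X → RTerm X → Prop) : Type u :=
  Quotient (RTerm.congSetoid R)

namespace PresentedRestrictionMonoid

instance instRestrictionMonoid {X : Type u} (R : RTerm X → RTerm X → Prop) :
    RestrictionMonoid (PresentedRestrictionMonoid R) where
  mul := Quotient.map₂ RTerm.mul (fun _ _ h _ _ k => RTerm.Cong.mul_congr h k)
  one := Quotient.mk _ RTerm.one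
  rstar := Quotient.map RTerm.star (fun _ _ h => RTerm.Cong.star_congr h)
  rplus := Quotient.map RTerm.plus (fun _ _ h => RTerm.Cong.plus_congr h)
  mul_assoc := by
    rintro ⟨a⟩ ⟨b⟩ ⟨c⟩; exact Quotient.sound (RTerm.Cong.mul_assoc a b c)
  one_mul := by rintro ⟨a⟩; exact Quotient.sound (RTerm.Cong.one_mul a)
  mul_one := by rintro ⟨a⟩; exact Quotient.sound (RTerm.Cong.mul_one a)
  mul_rstar_self := by rintro ⟨a⟩; exact Quotient.sound (RTerm.Cong.mul_star_self a)
  rstar_comm := by rintro ⟨a⟩ ⟨b⟩; exact Quotient.sound (RTerm.Cong.star_comm a b)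
  rstar_mul_rstar := by rintro ⟨a⟩ ⟨b⟩; exact Quotient.sound (RTerm.Cong.star_mul_star a b)
  rstar_mul := by rintro ⟨a⟩ ⟨b⟩; exact Quotient.sound (RTerm.Cong.star_mul a b)
  rplus_mul_self := by rintro ⟨a⟩; exact Quotient.sound (RTerm.Cong.plus_mul_self a)
  rplus_comm := by rintro ⟨a⟩ ⟨b⟩; exact Quotient.sound (RTerm.Cong.plus_comm a b)
  rplus_rplus_mul := by rintro ⟨a⟩ ⟨b⟩; exact Quotient.sound (RTerm.Cong.plus_plus_mul a b)
  mul_rplus := by rintro ⟨a⟩ ⟨b⟩; exact Quotient.sound (RTerm.Cong.mul_plus a b)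
  rstar_rplus := by rintro ⟨a⟩; exact Quotient.sound (RTerm.Cong.star_plus a)
  rplus_rstar := by rintro ⟨a⟩; exact Quotient.sound (RTerm.Cong.plus_star a)

/-- The image of a generator. -/
def of {X : Type u} (R : RTerm X → RTerm X → Prop) (x : X) : PresentedRestrictionMonoid R :=
  Quotient.mk _ (RTerm.gen x)

end PresentedRestrictionMonoid

/-- The relations, on generators `⌊m⌋` with `m ∈ M`, saying that `m ↦ ⌊m⌋` is a strong
premorphism. -/
inductive StrongRel (M : Type u) [Monoid M] : RTerm M → RTerm M → Prop
  /-- `⌊1⌋ = 1` -/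
  | one : StrongRel M (.gen 1) .one
  /-- `⌊m⌋⌊n⌋ = ⌊m⌋^+ ⌊mn⌋` -/
  | left (m n : M) :
      StrongRel M (.mul (.gen m) (.gen n)) (.mul (.plus (.gen m)) (.gen (m * n)))
  /-- `⌊m⌋⌊n⌋ = ⌊mn⌋ ⌊n⌋^*` -/
  | right (m n : M) :
      StrongRel M (.mul (.gen m) (.gen n)) (.mul (.gen (m * n)) (.star (.gen n)))

/-- `FR_s(M)`: the free restriction monoid over `M` with respect to strong premorphisms. -/
abbrev FRs (M : Type u) [Monoid M] : Type u := PresentedRestrictionMonoid (StrongRel M)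

/-- The inclusion `m ↦ ⌊m⌋` of `M` into `FR_s(M)`. -/
def FRs.of {M : Type u} [Monoid M] (m : M) : FRs M := PresentedRestrictionMonoid.of _ m

/-! ## Partial action products -/

/-- A premorphism `φ` from a monoid `T` to the symmetric inverse monoid of partial bijections of a
semilattice `Y` with top element, such that domains and ranges are nonempty order ideals and each
`φ t` is an order isomorphism from its domain onto its range. Partial bijections are composed as
functions, so that the product `φ s φ t` is `(φ t).trans (φ s)`, and are ordered by restriction. -/
structure PartialAction (T : Type u) (Y : Type v) [Monoid T] [SemilatticeInf Y] [OrderTop Y] where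
  φ : T → Y ≃. Y
  map_one : φ 1 = PEquiv.refl Y
  map_mul_le : ∀ s t : T, (φ t).trans (φ s) ≤ φ (s * t)
  dom_isLowerSet : ∀ t : T, IsLowerSet {y : Y | (φ t y).isSome}
  ran_isLowerSet : ∀ t : T, IsLowerSet {y : Y | ((φ t).symm y).isSome}
  le_iff_le : ∀ (t : T) (a b a' b' : Y), a' ∈ φ t a → b' ∈ φ t b → (a ≤ b ↔ a' ≤ b')
  dom_nonempty : ∀ t : T, {y : Y | (φ t y).isSome}.Nonempty

/-- The underlying set `{(y, t) | y ∈ ran (φ t)}` of the partial action product. -/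
@[ext]
structure PartialActionProduct {T : Type u} {Y : Type v} [Monoid T] [SemilatticeInf Y] [OrderTop Y]
    (D : PartialAction T Y) : Type (max u v) where
  fst : Y
  snd : T
  mem_ran : ((D.φ snd).symm fst).isSome

namespace PartialActionProduct

variable {T : Type u} {Y : Type v} [Monoid T] [SemilatticeInf Y] [OrderTop Y]
  {D : PartialAction T Y}

/-- For `a = (x, s)`, the element `φ(s)⁻¹(x)`. -/
def pre (a : PartialActionProduct D) : Y := ((D.φ a.snd).symm a.fst).get a.mem_ran

theorem fst_mem (a : PartialActionProduct D) : a.fst ∈ D.φ a.snd a.pre := by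
  rw [← PEquiv.mem_iff_mem]
  exact Option.get_mem _

theorem pre_eq (a : PartialActionProduct D) {x : Y} (h : a.fst ∈ D.φ a.snd x) : a.pre = x :=
  PEquiv.inj _ a.fst_mem h

theorem isSome_of_le (a : PartialActionProduct D) {y : Y} (h : y ≤ a.pre) :
    (D.φ a.snd y).isSome :=
  D.dom_isLowerSet a.snd h (Option.isSome_iff_exists.2 ⟨_, a.fst_mem⟩)

theorem exists_pre_of_le (D : PartialAction T Y) {s : T} {x y z : Y} (h : y ∈ D.φ s x)
    (hz : z ≤ y) : ∃ w, w ≤ x ∧ z ∈ D.φ s w := by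
  have h1 : ((D.φ s).symm z).isSome := D.ran_isLowerSet s hz
    (Option.isSome_iff_exists.2 ⟨x, (PEquiv.mem_iff_mem _).2 h⟩)
  obtain ⟨w, hw⟩ := Option.isSome_iff_exists.1 h1
  have hw' : z ∈ D.φ s w := (PEquiv.mem_iff_mem _).1 hw
  exact ⟨w, (D.le_iff_le s _ _ _ _ hw' h).2 hz, hw'⟩

theorem exists_of_le (D : PartialAction T Y) {s : T} {x y w : Y} (h : y ∈ D.φ s x)
    (hw : w ≤ x) : ∃ z, z ≤ y ∧ z ∈ D.φ s w := by
  obtain ⟨z, hz⟩ := Option.isSome_iff_exists.1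
    (D.dom_isLowerSet s hw (Option.isSome_iff_exists.2 ⟨_, h⟩))
  exact ⟨z, (D.le_iff_le s _ _ _ _ hz h).1 hw, hz⟩

theorem inf_mem (D : PartialAction T Y) {s : T} {a b a' b' : Y} (ha : a' ∈ D.φ s a)
    (hb : b' ∈ D.φ s b) : a' ⊓ b' ∈ D.φ s (a ⊓ b) := by
  obtain ⟨z, hza, hz⟩ := exists_of_le D ha (inf_le_left : a ⊓ b ≤ a)
  have hzb : z ≤ b' := (D.le_iff_le s _ _ _ _ hz hb).1 inf_le_right
  obtain ⟨w, hwa, hw⟩ := exists_pre_of_le D ha (inf_le_left : a' ⊓ b' ≤ a')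
  have hwb : w ≤ b := (D.le_iff_le s _ _ _ _ hw hb).2 inf_le_right
  have h : a' ⊓ b' ≤ z := (D.le_iff_le s _ _ _ _ hw hz).1 (le_inf hwa hwb)
  rwa [le_antisymm h (le_inf hza hzb)]

theorem mul_mem (D : PartialAction T Y) {s t : T} {x y z : Y} (h : y ∈ D.φ t x)
    (h' : z ∈ D.φ s y) : z ∈ D.φ (s * t) x :=
  D.map_mul_le s t x z ((PEquiv.mem_trans _ _ _ _).2 ⟨y, h, h'⟩)

theorem mem_one (D : PartialAction T Y) {x y : Y} : y ∈ D.φ 1 x ↔ y = x := by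
  rw [D.map_one]
  simp [eq_comm]

theorem isSome_of_mem (D : PartialAction T Y) {s : T} {x y : Y} (h : y ∈ D.φ s x) :
    ((D.φ s).symm y).isSome :=
  Option.isSome_iff_exists.2 ⟨x, (PEquiv.mem_iff_mem _).2 h⟩

/-- `φ(s)(φ(s)⁻¹(x) ∧ y)`, for `a = (x, s)`. -/
def act (a : PartialActionProduct D) (y : Y) : Y :=
  (D.φ a.snd (a.pre ⊓ y)).get (a.isSome_of_le inf_le_left)

theorem act_mem (a : PartialActionProduct D) (y : Y) : a.act y ∈ D.φ a.snd (a.pre ⊓ y) :=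
  Option.get_mem _

theorem act_eq (a : PartialActionProduct D) {y z : Y} (h : z ∈ D.φ a.snd (a.pre ⊓ y)) :
    a.act y = z :=
  Option.mem_unique (a.act_mem y) h

theorem exists_mul_mem (a b : PartialActionProduct D) :
    ∃ w, b.pre ⊓ w = w ∧ a.pre ⊓ b.fst ∈ D.φ b.snd w ∧ a.act b.fst ∈ D.φ (a.snd * b.snd) w := by
  obtain ⟨w, hw, h⟩ := exists_pre_of_le D b.fst_mem (inf_le_right : a.pre ⊓ b.fst ≤ b.fst)
  exact ⟨w, inf_eq_right.2 hw, h, mul_mem D h (a.act_mem _)⟩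

/-- `(x, s)(y, t) = (φ(s)(φ(s)⁻¹(x) ∧ y), st)` -/
instance : Mul (PartialActionProduct D) where
  mul a b := ⟨a.act b.fst, a.snd * b.snd, by
    obtain ⟨w, -, -, h⟩ := exists_mul_mem a b
    exact isSome_of_mem D h⟩

/-- The element `(y, 1)`. -/
def proj (D : PartialAction T Y) (y : Y) : PartialActionProduct D :=
  ⟨y, 1, isSome_of_mem D ((mem_one D).2 rfl)⟩

instance : One (PartialActionProduct D) where
  one := proj D ⊤

theorem mul_fst (a b : PartialActionProduct D) : (a * b).fst = a.act b.fst := rfl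

theorem mul_snd (a b : PartialActionProduct D) : (a * b).snd = a.snd * b.snd := rfl

theorem mul_pre (a b : PartialActionProduct D) {w : Y}
    (h : a.pre ⊓ b.fst ∈ D.φ b.snd w) : (a * b).pre = w :=
  pre_eq _ (mul_mem D h (a.act_mem _))

theorem proj_pre (y : Y) : (proj D y).pre = y := pre_eq _ ((mem_one D).2 rfl)

theorem proj_act (x y : Y) : (proj D x).act y = x ⊓ y :=
  act_eq _ ((mem_one D).2 (by rw [proj_pre]))

theorem proj_mul_proj (x y : Y) : proj D x * proj D y = proj D (x ⊓ y) :=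
  PartialActionProduct.ext (proj_act x y) (one_mul 1)

theorem proj_mul (x : Y) (a : PartialActionProduct D) : (proj D x * a).fst = x ⊓ a.fst :=
  proj_act x a.fst

theorem mul_proj_pre (a : PartialActionProduct D) (y : Y) : (a * proj D y).pre = a.pre ⊓ y :=
  mul_pre a _ ((mem_one D).2 rfl)

theorem act_pre (a : PartialActionProduct D) {y : Y} (h : a.pre ≤ y) : a.act y = a.fst :=
  act_eq _ (by rw [inf_eq_left.2 h]; exact a.fst_mem)

protected theorem mul_assoc' (a b c : PartialActionProduct D) : a * b * c = a * (b * c) := by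
  obtain ⟨w, hw, h, -⟩ := exists_mul_mem a b
  refine PartialActionProduct.ext ?_ (mul_assoc _ _ _)
  rw [mul_fst, mul_fst]
  refine act_eq _ ?_
  rw [mul_pre a b h]
  have h1 := inf_mem D h (b.act_mem c.fst)
  have e1 : w ⊓ (b.pre ⊓ c.fst) = w ⊓ c.fst := by
    rw [← inf_assoc, inf_comm w, hw]
  have e2 : b.act c.fst ≤ b.fst :=
    (D.le_iff_le b.snd _ _ _ _ (b.act_mem c.fst) b.fst_mem).1 inf_le_left
  have e3 : a.pre ⊓ b.fst ⊓ b.act c.fst = a.pre ⊓ b.act c.fst := by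
    rw [inf_assoc, inf_eq_right.2 e2]
  rw [e1, e3] at h1
  exact mul_mem D h1 (a.act_mem _)

/-- The partial action product as a restriction monoid, with `(x, s)^* = (φ(s)⁻¹(x), 1)`,
`(x, s)^+ = (x, 1)` and identity element `(⊤, 1)`. -/
instance instRestrictionMonoid : RestrictionMonoid (PartialActionProduct D) where
  mul_assoc := PartialActionProduct.mul_assoc'
  one_mul a := PartialActionProduct.ext ((proj_mul _ a).trans (top_inf_eq _)) (one_mul _)
  mul_one a := PartialActionProduct.ext (act_pre a le_top) (mul_one _)
  rstar a := proj D a.pre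
  rplus a := proj D a.fst
  mul_rstar_self a := PartialActionProduct.ext (act_pre a le_rfl) (mul_one _)
  rstar_comm a b := by rw [proj_mul_proj, proj_mul_proj, inf_comm]
  rstar_mul_rstar a b := by rw [proj_mul_proj, mul_proj_pre]
  rstar_mul a b := by
    refine PartialActionProduct.ext ?_ ((one_mul _).trans (mul_one _).symm)
    obtain ⟨w, hw, h, -⟩ := exists_mul_mem a b
    rw [proj_mul, mul_fst]
    refine (act_eq _ ?_).symm
    change _ ∈ D.φ _ (b.pre ⊓ (a * b).pre)
    rw [mul_pre a b h, hw]
    exact h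
  rplus_mul_self a := PartialActionProduct.ext ((proj_mul _ a).trans (inf_idem _)) (one_mul _)
  rplus_comm a b := by rw [proj_mul_proj, proj_mul_proj, inf_comm]
  rplus_rplus_mul a b := by rw [proj_mul_proj, proj_mul]
  mul_rplus a b := by
    refine PartialActionProduct.ext ?_ ((mul_one _).trans (one_mul _).symm)
    rw [proj_mul, mul_fst, mul_fst]
    exact (inf_eq_left.2
      ((D.le_iff_le a.snd _ _ _ _ (a.act_mem b.fst) a.fst_mem).1 inf_le_left)).symm
  rstar_rplus a := by rw [proj_pre]
  rplus_rstar a := rfl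

end PartialActionProduct

/-! ## Inverse monoids -/

/-- Inverse monoids, as algebras of type `(2,1,0)`. -/
class InverseMonoid (S : Type u) extends Monoid S, Inv S where
  inv_inv' : ∀ x : S, x⁻¹⁻¹ = x
  mul_inv_rev' : ∀ x y : S, (x * y)⁻¹ = y⁻¹ * x⁻¹
  mul_inv_mul_self : ∀ x : S, x * x⁻¹ * x = x
  mul_inv_comm : ∀ x y : S, x * x⁻¹ * (y * y⁻¹) = y * y⁻¹ * (x * x⁻¹)

namespace InverseMonoid

variable {S : Type u} [InverseMonoid S]

theorem inv_mul_comm (x y : S) : x⁻¹ * x * (y⁻¹ * y) = y⁻¹ * y * (x⁻¹ * x) := by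
  have h := mul_inv_comm x⁻¹ y⁻¹
  rwa [inv_inv', inv_inv'] at h

theorem mixed_comm (x y : S) : x * x⁻¹ * (y⁻¹ * y) = y⁻¹ * y * (x * x⁻¹) := by
  have h := mul_inv_comm x y⁻¹
  rwa [inv_inv'] at h

theorem inv_mul_inv_self (x : S) : x⁻¹ * x * x⁻¹ = x⁻¹ := by
  have h := mul_inv_mul_self x⁻¹
  rwa [inv_inv'] at h

/-- An inverse monoid is a restriction monoid with `a^* = a⁻¹ a` and `a^+ = a a⁻¹`. -/
instance instRestrictionMonoid : RestrictionMonoid S where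
  rstar a := a⁻¹ * a
  rplus a := a * a⁻¹
  mul_rstar_self x := by rw [← mul_assoc, mul_inv_mul_self]
  rstar_comm := inv_mul_comm
  rstar_mul_rstar x y := by
    have h : y⁻¹ * y * (x⁻¹ * (x * (y⁻¹ * y))) = x⁻¹ * x * (y⁻¹ * y) := by
      rw [← mul_assoc x⁻¹, ← mul_assoc, inv_mul_comm y x, mul_assoc, ← mul_assoc (y⁻¹ * y),
        inv_mul_inv_self]
    rw [mul_inv_rev', mul_inv_rev', inv_inv', mul_assoc]
    exact h
  rstar_mul x y := by
    have h : y * y⁻¹ * (x⁻¹ * x) * y = x⁻¹ * x * y := by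
      rw [mixed_comm, mul_assoc, mul_inv_mul_self]
    rw [mul_inv_rev', ← h]
    simp only [mul_assoc]
  rplus_mul_self := mul_inv_mul_self
  rplus_comm := mul_inv_comm
  rplus_rplus_mul x y := by
    have h : x * x⁻¹ * (y * y⁻¹) * (x * x⁻¹) = x * x⁻¹ * (y * y⁻¹) := by
      rw [mul_inv_comm x y, mul_assoc, ← mul_assoc (x * x⁻¹), mul_inv_mul_self]
    rw [← h, mul_inv_rev', mul_inv_rev', inv_inv']
    simp only [mul_assoc]
  mul_rplus x y := by
    have h : x * (x⁻¹ * x * (y * y⁻¹)) = x * (y * y⁻¹) := by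
      rw [← mul_assoc, ← mul_assoc x x⁻¹ x, mul_inv_mul_self]
    rw [mul_inv_rev', ← h, ← mixed_comm]
    simp only [mul_assoc]
  rstar_rplus x := by
    rw [mul_inv_rev', inv_inv', ← mul_assoc, mul_inv_mul_self]
  rplus_rstar x := by
    rw [mul_inv_rev', inv_inv', ← mul_assoc, inv_mul_inv_self]

theorem inv_eq_of_idem {e : S} (h : e * e = e) : e⁻¹ = e := by
  have h' : e⁻¹ * e⁻¹ = e⁻¹ := by rw [← mul_inv_rev', h]
  calc e⁻¹ = e⁻¹ * e * e⁻¹ := (inv_mul_inv_self e).symm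
    _ = e⁻¹ * e * (e * e⁻¹) := by rw [← mul_assoc, mul_assoc e⁻¹ e e, h]
    _ = e * e⁻¹ * (e⁻¹ * e) := (mixed_comm e e).symm
    _ = e * e⁻¹ * e := by rw [← mul_assoc, mul_assoc e e⁻¹ e⁻¹, h']
    _ = e := mul_inv_mul_self e

theorem idem_comm {e f : S} (he : e * e = e) (hf : f * f = f) : e * f = f * e := by
  have h := mul_inv_comm e f
  rwa [inv_eq_of_idem he, inv_eq_of_idem hf, he, hf] at h

theorem inv_mul_self_idem (x : S) : x⁻¹ * x * (x⁻¹ * x) = x⁻¹ * x := by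
  rw [← mul_assoc, inv_mul_inv_self]

theorem mul_inv_self_idem (x : S) : x * x⁻¹ * (x * x⁻¹) = x * x⁻¹ := by
  rw [← mul_assoc, mul_inv_mul_self]

/-- The set `E(S)` of idempotents of an inverse monoid. -/
def Idem (S : Type u) [InverseMonoid S] : Type u := {e : S // e * e = e}

/-- `E(S)` is a semilattice under multiplication, with top element `1`; `e ≤ f` means `e = e f`,
which is the restriction to `E(S)` of the natural partial order. -/
instance instSemilatticeInfIdem : SemilatticeInf (Idem S) where
  le e f := e.1 * f.1 = e.1
  le_refl e := e.2
  le_trans e f g h k := by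
    rw [← show e.1 * f.1 = e.1 from h, mul_assoc, show f.1 * g.1 = f.1 from k]
  le_antisymm e f h k := Subtype.ext <| by
    rw [← show e.1 * f.1 = e.1 from h, idem_comm e.2 f.2]
    exact k
  inf e f := ⟨e.1 * f.1, by
    rw [mul_assoc, ← mul_assoc f.1, idem_comm f.2 e.2, mul_assoc e.1, f.2, ← mul_assoc, e.2]⟩
  inf_le_left e f := by
    change e.1 * f.1 * e.1 = e.1 * f.1
    rw [idem_comm e.2 f.2, mul_assoc, e.2]
  inf_le_right e f := by
    change e.1 * f.1 * f.1 = e.1 * f.1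
    rw [mul_assoc, f.2]
  le_inf e f g h k := by
    change e.1 * (f.1 * g.1) = e.1
    rw [← mul_assoc, show e.1 * f.1 = e.1 from h]
    exact k

instance instOrderTopIdem : OrderTop (Idem S) where
  top := ⟨1, one_mul 1⟩
  le_top e := mul_one e.1

theorem idem_le_iff {e f : Idem S} : e ≤ f ↔ e.1 * f.1 = e.1 := Iff.rfl

/-- `a a⁻¹` as an element of `E(S)`. -/
def ran (a : S) : Idem S := ⟨a * a⁻¹, mul_inv_self_idem a⟩

/-- `a⁻¹ a` as an element of `E(S)`. -/
def dom (a : S) : Idem S := ⟨a⁻¹ * a, inv_mul_self_idem a⟩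

/-- `a e a⁻¹` as an element of `E(S)`. -/
def conj (a : S) (e : Idem S) : Idem S := ⟨a * e.1 * a⁻¹, by
  have h : e.1 * (a⁻¹ * a) * e.1 = e.1 * (a⁻¹ * a) := by
    rw [mul_assoc, idem_comm (inv_mul_self_idem a) e.2, ← mul_assoc, e.2]
  calc a * e.1 * a⁻¹ * (a * e.1 * a⁻¹) = a * (e.1 * (a⁻¹ * a) * e.1) * a⁻¹ := by
        simp only [mul_assoc]
    _ = a * e.1 * (a⁻¹ * a * a⁻¹) := by rw [h]; simp only [mul_assoc]
    _ = a * e.1 * a⁻¹ := by rw [inv_mul_inv_self]⟩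

theorem conj_le (a : S) (e : Idem S) : conj a e ≤ ran a := by
  change a * e.1 * a⁻¹ * (a * a⁻¹) = a * e.1 * a⁻¹
  rw [mul_assoc, ← mul_assoc a⁻¹, inv_mul_inv_self]

theorem conj_conj (a : S) {e : Idem S} (h : e ≤ dom a) : conj a⁻¹ (conj a e) = e := by
  apply Subtype.ext
  have h' : e.1 * (a⁻¹ * a) = e.1 := h
  change a⁻¹ * (a * e.1 * a⁻¹) * a⁻¹⁻¹ = e.1
  calc a⁻¹ * (a * e.1 * a⁻¹) * a⁻¹⁻¹ = (a⁻¹ * a) * (e.1 * (a⁻¹ * a)) := by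
        rw [inv_inv']; simp only [mul_assoc]
    _ = e.1 := by rw [h', idem_comm (inv_mul_self_idem a) e.2, h']

theorem conj_conj' (a : S) {e : Idem S} (h : e ≤ ran a) : conj a (conj a⁻¹ e) = e := by
  have h2 : e ≤ dom a⁻¹ := by
    change e.1 * (a⁻¹⁻¹ * a⁻¹) = e.1
    rw [inv_inv']
    exact h
  have := conj_conj a⁻¹ h2
  rwa [inv_inv'] at this

theorem conj_inv_le (a : S) (e : Idem S) : conj a⁻¹ e ≤ dom a := by
  have h := conj_le a⁻¹ e
  rw [idem_le_iff] at h ⊢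
  change _ * (a⁻¹ * a⁻¹⁻¹) = _ at h
  rwa [inv_inv'] at h

theorem conj_mono (a : S) {e f : Idem S} (h : e ≤ f) : conj a e ≤ conj a f := by
  have h' : e.1 * f.1 = e.1 := h
  change a * e.1 * a⁻¹ * (a * f.1 * a⁻¹) = a * e.1 * a⁻¹
  calc a * e.1 * a⁻¹ * (a * f.1 * a⁻¹) = a * (e.1 * ((a⁻¹ * a) * f.1)) * a⁻¹ := by
        simp only [mul_assoc]
    _ = a * (e.1 * f.1) * (a⁻¹ * a * a⁻¹) := by
        rw [idem_comm (inv_mul_self_idem a) f.2]; simp only [mul_assoc]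
    _ = a * e.1 * a⁻¹ := by rw [h', inv_mul_inv_self]

open Classical in
/-- The Munn representation: `a` acts on `E(S)` by the partial bijection
`{e | e ≤ a⁻¹ a} → {f | f ≤ a a⁻¹}`, `e ↦ a e a⁻¹`. -/
noncomputable def munn (a : S) : Idem S ≃. Idem S where
  toFun e := if e ≤ dom a then some (conj a e) else none
  invFun e := if e ≤ ran a then some (conj a⁻¹ e) else none
  inv e f := by
    simp only [Option.ite_none_right_eq_some, Option.some.injEq]
    constructor
    · rintro ⟨h, rfl⟩
      exact ⟨conj_inv_le a f, conj_conj' a h⟩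
    · rintro ⟨h, rfl⟩
      exact ⟨conj_le a e, conj_conj a h⟩

theorem mem_munn {a : S} {e f : Idem S} : f ∈ munn a e ↔ e ≤ dom a ∧ conj a e = f := by
  classical
  change (if e ≤ dom a then some (conj a e) else none) = some f ↔ _
  simp

theorem munn_isSome {a : S} {e : Idem S} : (munn a e).isSome ↔ e ≤ dom a := by
  rw [Option.isSome_iff_exists]
  exact ⟨fun ⟨f, h⟩ => (mem_munn.1 h).1, fun h => ⟨_, mem_munn.2 ⟨h, rfl⟩⟩⟩

theorem munn_symm_isSome {a : S} {e : Idem S} : ((munn a).symm e).isSome ↔ e ≤ ran a := by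
  rw [Option.isSome_iff_exists]
  constructor
  · rintro ⟨f, h⟩
    obtain ⟨-, rfl⟩ := mem_munn.1 ((PEquiv.mem_iff_mem _).1 h)
    exact conj_le a f
  · intro h
    exact ⟨conj a⁻¹ e, (PEquiv.mem_iff_mem _).2
      (mem_munn.2 ⟨conj_inv_le a e, conj_conj' a h⟩)⟩

/-- If `a b ≤ c` in the natural partial order, then the composite of the partial bijections of
`b` and `a` is a restriction of that of `c`. -/
theorem munn_trans_le {a b c : S} (h : RestrictionMonoid.NatLE (a * b) c) :
    (munn b).trans (munn a) ≤ munn c := by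
  obtain ⟨p, ⟨x, rfl⟩, h⟩ := h
  intro e f hf
  obtain ⟨g, hg, hf⟩ := (PEquiv.mem_trans _ _ _ _).1 hf
  obtain ⟨h1, rfl⟩ := mem_munn.1 hg
  obtain ⟨h2, rfl⟩ := mem_munn.1 hf
  have hp : (x⁻¹ * x) * (x⁻¹ * x) = x⁻¹ * x := inv_mul_self_idem x
  change a * b = x⁻¹ * x * c at h
  generalize x⁻¹ * x = p at hp h
  have hpi := inv_eq_of_idem hp
  -- `e ≤ (ab)⁻¹ (ab)`
  have h3 : e.1 * (b⁻¹ * b) = e.1 := h1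
  have h4 : b * e.1 * b⁻¹ * (a⁻¹ * a) = b * e.1 * b⁻¹ := h2
  have h5 : e.1 * ((a * b)⁻¹ * (a * b)) = e.1 := by
    have hbe : b⁻¹ * b * e.1 = e.1 := by rw [idem_comm (inv_mul_self_idem b) e.2, h3]
    calc e.1 * ((a * b)⁻¹ * (a * b)) = b⁻¹ * b * e.1 * ((a * b)⁻¹ * (a * b)) := by rw [hbe]
      _ = b⁻¹ * (b * e.1 * b⁻¹ * (a⁻¹ * a)) * b := by
          rw [mul_inv_rev']; simp only [mul_assoc]
      _ = b⁻¹ * b * e.1 * (b⁻¹ * b) := by rw [h4]; simp only [mul_assoc]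
      _ = e.1 := by rw [hbe, h3]
  have h6 : (a * b)⁻¹ * (a * b) * (c⁻¹ * c) = (a * b)⁻¹ * (a * b) := by
    rw [h, mul_inv_rev', hpi]
    calc c⁻¹ * p * (p * c) * (c⁻¹ * c) = c⁻¹ * p * (p * (c * c⁻¹ * c)) := by
          simp only [mul_assoc]
      _ = c⁻¹ * p * (p * c) := by rw [mul_inv_mul_self]
  have h7 : e ≤ dom c := by
    change e.1 * (c⁻¹ * c) = e.1
    conv_lhs => rw [← h5, mul_assoc, h6]
    exact h5
  refine mem_munn.2 ⟨h7, ?_⟩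
  apply Subtype.ext
  change c * e.1 * c⁻¹ = a * (b * e.1 * b⁻¹) * a⁻¹
  have h8 : c * ((a * b)⁻¹ * (a * b)) = a * b := by
    rw [h, mul_inv_rev', hpi]
    calc c * (c⁻¹ * p * (p * c)) = (c * c⁻¹) * (p * p) * c := by simp only [mul_assoc]
      _ = p * (c * c⁻¹ * c) := by
          rw [hp, idem_comm (mul_inv_self_idem c) hp, mul_assoc]
      _ = p * c := by rw [mul_inv_mul_self]
  have h9 : c * e.1 = a * b * e.1 := by
    conv_lhs => rw [← h5, idem_comm e.2 (inv_mul_self_idem (a * b)), ← mul_assoc, h8]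
  have h10 : e.1 * c⁻¹ = e.1 * (a * b)⁻¹ := by
    have := congrArg (·⁻¹) h9
    simpa only [mul_inv_rev', inv_eq_of_idem e.2] using this
  calc c * e.1 * c⁻¹ = c * e.1 * (e.1 * c⁻¹) := by
        rw [← mul_assoc, mul_assoc c e.1 e.1, e.2]
    _ = a * b * (e.1 * e.1) * (a * b)⁻¹ := by rw [h9, h10]; simp only [mul_assoc]
    _ = a * (b * e.1 * b⁻¹) * a⁻¹ := by
        rw [e.2, mul_inv_rev']; simp only [mul_assoc]

/-- The composite of a premorphism `θ` from a monoid `M` to an inverse monoid `S` with the Munn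
representation of `S`. -/
noncomputable def munnAction {M : Type v} [Monoid M] (θ : M → S) (hθ : IsPremorphism θ) :
    PartialAction M (Idem S) where
  φ m := munn (θ m)
  map_one := by
    refine PEquiv.ext fun e => Option.ext fun f => ?_
    rw [hθ.map_one, ← Option.mem_def, mem_munn, PEquiv.refl_apply]
    have h1 : (1 : S)⁻¹ = 1 := inv_eq_of_idem (one_mul 1)
    have h2 : conj 1 e = e := Subtype.ext (by
      change 1 * e.1 * 1⁻¹ = e.1
      rw [h1, one_mul, mul_one])
    have h3 : e ≤ dom 1 := by
      change e.1 * (1⁻¹ * 1) = e.1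
      rw [h1, mul_one, mul_one]
    simp [h2, h3]
  map_mul_le s t := munn_trans_le (hθ.map_mul_le s t)
  dom_isLowerSet t e f h he := munn_isSome.2 (h.trans (munn_isSome.1 he))
  ran_isLowerSet t e f h he := munn_symm_isSome.2 (h.trans (munn_symm_isSome.1 he))
  le_iff_le t a b a' b' ha hb := by
    obtain ⟨ha', rfl⟩ := mem_munn.1 ha
    obtain ⟨hb', rfl⟩ := mem_munn.1 hb
    refine ⟨conj_mono _, fun h => ?_⟩
    have h' := conj_mono (θ t)⁻¹ h
    rwa [conj_conj _ ha', conj_conj _ hb'] at h'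
  dom_nonempty t := ⟨dom (θ t), munn_isSome.2 le_rfl⟩

end InverseMonoid

/-! ## The generalized prefix expansion -/

section PrefixExpansionSection

open InverseMonoid

/-- The generalized prefix expansion `S^pr` of an inverse monoid `S`: pairs `(A, s)` where `A` is a
finite subset of the `R`-class `{a | a a⁻¹ = s s⁻¹}` of `s ∈ S`, with `s ∈ A` and `s s⁻¹ ∈ A`. -/
@[ext]
structure PrefixExpansion (S : Type u) [InverseMonoid S] : Type u where
  set : Set S
  elt : S
  finite : set.Finite
  ran_eq : ∀ a ∈ set, a * a⁻¹ = elt * elt⁻¹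
  elt_mem : elt ∈ set
  ran_mem : elt * elt⁻¹ ∈ set

namespace PrefixExpansion

variable {S : Type u} [InverseMonoid S]

theorem ran_mul (s t : S) : s * t * (s * t)⁻¹ = s * (t * t⁻¹) * s⁻¹ := by
  rw [mul_inv_rev']; simp only [mul_assoc]

theorem ran_mul_of_idem {g : S} (hg : g * g = g) (a : S) :
    g * a * (g * a)⁻¹ = g * (a * a⁻¹) := by
  rw [ran_mul, inv_eq_of_idem hg, mul_assoc, ← idem_comm hg (mul_inv_self_idem a), ← mul_assoc, hg]

theorem ran_mul_le (s t : S) : s * t * (s * t)⁻¹ * (s * s⁻¹) = s * t * (s * t)⁻¹ := by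
  rw [ran_mul, mul_assoc, ← mul_assoc s⁻¹, inv_mul_inv_self]

theorem ran_elt_mul (x : PrefixExpansion S) {a : S} (h : a ∈ x.set) :
    x.elt * x.elt⁻¹ * a = a := by
  rw [← x.ran_eq a h, mul_inv_mul_self]

/-- `(A, s)(B, t) = ((st)(st)⁻¹ A ∪ s B, st)` -/
instance : Mul (PrefixExpansion S) where
  mul x y :=
    { set := (fun a => x.elt * y.elt * (x.elt * y.elt)⁻¹ * a) '' x.set ∪
        (fun b => x.elt * b) '' y.set
      elt := x.elt * y.elt
      finite := (x.finite.image _).union (y.finite.image _)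
      ran_eq := by
        rintro _ (⟨a, ha, rfl⟩ | ⟨b, hb, rfl⟩)
        · dsimp only
          rw [ran_mul_of_idem (mul_inv_self_idem _), x.ran_eq a ha, ran_mul_le]
        · dsimp only
          rw [ran_mul, y.ran_eq b hb, ran_mul]
      elt_mem := Or.inr ⟨_, y.elt_mem, rfl⟩
      ran_mem := Or.inl ⟨_, x.ran_mem, ran_mul_le _ _⟩ }

/-- `(A, s)⁻¹ = (s⁻¹ A, s⁻¹)` -/
instance : Inv (PrefixExpansion S) where
  inv x :=
    { set := (fun a => x.elt⁻¹ * a) '' x.set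
      elt := x.elt⁻¹
      finite := x.finite.image _
      ran_eq := by
        rintro _ ⟨a, ha, rfl⟩
        dsimp only
        rw [ran_mul, x.ran_eq a ha, inv_inv', ← mul_assoc, inv_mul_inv_self]
      elt_mem := ⟨_, x.ran_mem, by dsimp only; rw [← mul_assoc, inv_mul_inv_self]⟩
      ran_mem := ⟨_, x.elt_mem, by dsimp only; rw [inv_inv']⟩ }

/-- The identity element `({1}, 1)`. -/
instance : One (PrefixExpansion S) where
  one :=
    { set := {1}
      elt := 1
      finite := Set.finite_singleton 1
      ran_eq := by rintro _ rfl; rfl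
      elt_mem := rfl
      ran_mem := by rw [inv_eq_of_idem (one_mul (1 : S)), one_mul]; rfl }

theorem mul_elt (x y : PrefixExpansion S) : (x * y).elt = x.elt * y.elt := rfl

theorem mem_mul {x y : PrefixExpansion S} {c : S} : c ∈ (x * y).set ↔
    (∃ a ∈ x.set, x.elt * y.elt * (x.elt * y.elt)⁻¹ * a = c) ∨ ∃ b ∈ y.set, x.elt * b = c :=
  Iff.rfl

theorem inv_elt (x : PrefixExpansion S) : (x⁻¹).elt = x.elt⁻¹ := rfl

theorem mem_inv {x : PrefixExpansion S} {c : S} :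
    c ∈ (x⁻¹).set ↔ ∃ a ∈ x.set, x.elt⁻¹ * a = c := Iff.rfl

theorem one_elt : (1 : PrefixExpansion S).elt = 1 := rfl

theorem mem_one {c : S} : c ∈ (1 : PrefixExpansion S).set ↔ c = 1 := Iff.rfl

theorem ext' {x y : PrefixExpansion S} (h : ∀ c, c ∈ x.set ↔ c ∈ y.set) (h' : x.elt = y.elt) :
    x = y := PrefixExpansion.ext (Set.ext h) h'

theorem ran_mul_mul (s t : S) : s * t * (s * t)⁻¹ * s = s * (t * t⁻¹) := by
  rw [mul_inv_rev']
  calc s * t * (t⁻¹ * s⁻¹) * s = s * (t * t⁻¹ * (s⁻¹ * s)) := by simp only [mul_assoc]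
    _ = s * (t * t⁻¹) := by
      rw [mixed_comm, ← mul_assoc, ← mul_assoc s s⁻¹ s, mul_inv_mul_self]

protected theorem mul_assoc' (x y z : PrefixExpansion S) : x * y * z = x * (y * z) := by
  refine ext' (fun c => ?_) (mul_assoc _ _ _)
  have h1 : ∀ a, x.elt * y.elt * z.elt * (x.elt * y.elt * z.elt)⁻¹ *
      (x.elt * y.elt * (x.elt * y.elt)⁻¹ * a) =
      x.elt * (y.elt * z.elt) * (x.elt * (y.elt * z.elt))⁻¹ * a := fun a => by
    rw [← mul_assoc, ran_mul_le, mul_assoc x.elt]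
  have h2 : ∀ b, x.elt * y.elt * z.elt * (x.elt * y.elt * z.elt)⁻¹ * (x.elt * b) =
      x.elt * (y.elt * z.elt * (y.elt * z.elt)⁻¹ * b) := fun b => by
    rw [← mul_assoc, mul_assoc x.elt y.elt, ran_mul_mul, mul_assoc]
  simp only [mem_mul, mul_elt]
  constructor
  · rintro (⟨_, (⟨a, ha, rfl⟩ | ⟨b, hb, rfl⟩), rfl⟩ | ⟨d, hd, rfl⟩)
    · exact Or.inl ⟨a, ha, (h1 a).symm⟩
    · exact Or.inr ⟨_, Or.inl ⟨b, hb, rfl⟩, (h2 b).symm⟩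
    · exact Or.inr ⟨_, Or.inr ⟨d, hd, rfl⟩, (mul_assoc _ _ _).symm⟩
  · rintro (⟨a, ha, rfl⟩ | ⟨_, (⟨b, hb, rfl⟩ | ⟨d, hd, rfl⟩), rfl⟩)
    · exact Or.inl ⟨_, Or.inl ⟨a, ha, rfl⟩, h1 a⟩
    · exact Or.inl ⟨_, Or.inr ⟨b, hb, rfl⟩, h2 b⟩
    · exact Or.inr ⟨d, hd, mul_assoc _ _ _⟩

protected theorem one_mul' (x : PrefixExpansion S) : 1 * x = x := by
  refine ext' (fun c => ?_) (one_mul _)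
  simp only [mem_mul, mem_one, one_elt, one_mul, exists_eq_left, exists_eq_right, mul_one]
  constructor
  · rintro (rfl | h)
    · exact x.ran_mem
    · exact h
  · exact Or.inr

protected theorem mul_one' (x : PrefixExpansion S) : x * 1 = x := by
  refine ext' (fun c => ?_) (mul_one _)
  simp only [mem_mul, mem_one, one_elt, mul_one, exists_eq_left]
  constructor
  · rintro (⟨a, ha, rfl⟩ | rfl)
    · rwa [ran_elt_mul x ha]
    · exact x.elt_mem
  · exact fun h => Or.inl ⟨c, h, ran_elt_mul x h⟩

instance instMonoid : Monoid (PrefixExpansion S) where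
  mul_assoc := PrefixExpansion.mul_assoc'
  one_mul := PrefixExpansion.one_mul'
  mul_one := PrefixExpansion.mul_one'

theorem mul_inv_elt (x : PrefixExpansion S) : (x * x⁻¹).elt = x.elt * x.elt⁻¹ := rfl

theorem mem_mul_inv {x : PrefixExpansion S} {c : S} : c ∈ (x * x⁻¹).set ↔ c ∈ x.set := by
  have h : ∀ a ∈ x.set, x.elt * x.elt⁻¹ * (x.elt * x.elt⁻¹)⁻¹ * a = a := fun a ha => by
    rw [inv_eq_of_idem (mul_inv_self_idem x.elt), mul_inv_self_idem, ran_elt_mul x ha]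
  simp only [mem_mul, mem_inv, inv_elt]
  constructor
  · rintro (⟨a, ha, rfl⟩ | ⟨_, ⟨a, ha, rfl⟩, rfl⟩)
    · rwa [h a ha]
    · rwa [← mul_assoc, ran_elt_mul x ha]
  · exact fun hc => Or.inl ⟨c, hc, h c hc⟩

instance instInverseMonoid : InverseMonoid (PrefixExpansion S) where
  inv_inv' x := by
    refine ext' (fun c => ?_) (inv_inv' _)
    simp only [mem_inv, inv_elt, inv_inv']
    constructor
    · rintro ⟨_, ⟨a, ha, rfl⟩, rfl⟩
      rwa [← mul_assoc, ran_elt_mul x ha]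
    · exact fun h => ⟨_, ⟨c, h, rfl⟩, by rw [← mul_assoc, ran_elt_mul x h]⟩
  mul_inv_rev' x y := by
    refine ext' (fun c => ?_) (mul_inv_rev' _ _)
    have h1 : ∀ a, (x.elt * y.elt)⁻¹ * (x.elt * y.elt * (x.elt * y.elt)⁻¹ * a) =
        y.elt⁻¹ * (x.elt⁻¹ * a) := fun a => by
      rw [← mul_assoc, ← mul_assoc (x.elt * y.elt)⁻¹, inv_mul_inv_self, mul_inv_rev', mul_assoc]
    have h2 : ∀ b, (x.elt * y.elt)⁻¹ * (x.elt * b) =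
        y.elt⁻¹ * x.elt⁻¹ * (y.elt⁻¹ * x.elt⁻¹)⁻¹ * (y.elt⁻¹ * b) := fun b => by
      rw [← mul_assoc _ y.elt⁻¹, ran_mul_mul, mul_inv_rev', inv_inv']
      simp only [mul_assoc]
    simp only [mem_inv, mem_mul, mul_elt, inv_elt]
    constructor
    · rintro ⟨_, (⟨a, ha, rfl⟩ | ⟨b, hb, rfl⟩), rfl⟩
      · exact Or.inr ⟨_, ⟨a, ha, rfl⟩, (h1 a).symm⟩
      · exact Or.inl ⟨_, ⟨b, hb, rfl⟩, (h2 b).symm⟩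
    · rintro (⟨_, ⟨b, hb, rfl⟩, rfl⟩ | ⟨_, ⟨a, ha, rfl⟩, rfl⟩)
      · exact ⟨_, Or.inr ⟨b, hb, rfl⟩, h2 b⟩
      · exact ⟨_, Or.inl ⟨a, ha, rfl⟩, h1 a⟩
  mul_inv_mul_self x := by
    refine ext' (fun c => ?_) (mul_inv_mul_self x.elt)
    rw [mem_mul]
    simp only [mem_mul_inv, mul_inv_elt]
    rw [mul_inv_mul_self]
    constructor
    · rintro (⟨a, ha, rfl⟩ | ⟨a, ha, rfl⟩) <;> rwa [ran_elt_mul x ha]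
    · exact fun h => Or.inr ⟨c, h, ran_elt_mul x h⟩
  mul_inv_comm x y := by
    have key : ∀ (x y : PrefixExpansion S) (c : S), c ∈ (x * x⁻¹ * (y * y⁻¹)).set ↔
        (∃ a ∈ x.set, y.elt * y.elt⁻¹ * a = c) ∨ ∃ b ∈ y.set, x.elt * x.elt⁻¹ * b = c := by
      intro x y c
      rw [mem_mul]
      simp only [mem_mul_inv, mul_inv_elt]
      refine or_congr (exists_congr fun a => and_congr_right fun ha => ?_) Iff.rfl
      rw [ran_mul_of_idem (mul_inv_self_idem x.elt),
        inv_eq_of_idem (mul_inv_self_idem y.elt), mul_inv_self_idem, mul_inv_comm, mul_assoc,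
        ran_elt_mul x ha]
    refine ext' (fun c => ?_) (mul_inv_comm x.elt y.elt)
    rw [key, key, or_comm]

/-- The map `S → S^pr`, `s ↦ ({s s⁻¹, s}, s)`. -/
def of (s : S) : PrefixExpansion S where
  set := {s * s⁻¹, s}
  elt := s
  finite := Set.toFinite _
  ran_eq := by
    rintro _ (rfl | rfl)
    · rw [inv_eq_of_idem (mul_inv_self_idem s), mul_inv_self_idem]
    · rfl
  elt_mem := Or.inr rfl
  ran_mem := Or.inl rfl

theorem isPremorphism_of : IsPremorphism (of : S → PrefixExpansion S) where
  map_one := by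
    refine ext' (fun c => ?_) rfl
    change c = 1 * 1⁻¹ ∨ c = 1 ↔ c = 1
    rw [inv_eq_of_idem (one_mul (1 : S)), one_mul, or_self]
  map_mul_le s t := by
    refine ⟨of s * of t * (of s * of t)⁻¹, ⟨(of s * of t)⁻¹, ?_⟩, ?_⟩
    · change (of s * of t)⁻¹⁻¹ * (of s * of t)⁻¹ = _
      rw [inv_inv']
    · refine ext' (fun c => ?_) (mul_inv_mul_self (s * t)).symm
      have h0 : (of s * of t).elt = s * t := rfl
      have h1 : (of s * of t * (of s * of t)⁻¹).elt = s * t * (s * t)⁻¹ := rfl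
      have h2 : (of (s * t)).elt = s * t := rfl
      constructor
      · intro h
        refine mem_mul.2 (Or.inl ⟨c, mem_mul_inv.2 h, ?_⟩)
        rw [h1, h2, mul_inv_mul_self, ← h0, ran_elt_mul _ h]
      · intro h
        rcases mem_mul.1 h with ⟨a, ha, rfl⟩ | ⟨b, hb, rfl⟩
        · have ha' := mem_mul_inv.1 ha
          rw [h1, h2, mul_inv_mul_self, ← h0, ran_elt_mul _ ha']
          exact ha'
        · rw [h1]
          rcases hb with rfl | rfl
          · rw [mul_inv_self_idem]
            exact (of s * of t).ran_mem
          · rw [mul_inv_mul_self]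
            exact (of s * of t).elt_mem

end PrefixExpansion

/-- The partial action of `S` on `E(S^pr)` given by `s ↦ ({s s⁻¹, s}, s)` followed by the Munn
representation of `S^pr`. -/
noncomputable def prefixAction (S : Type u) [InverseMonoid S] :
    PartialAction S (Idem (PrefixExpansion S)) :=
  munnAction PrefixExpansion.of PrefixExpansion.isPremorphism_of

end PrefixExpansionSection

/-! The elements `gen s`, with coordinates `[s][s]⁻¹` and `s`, form a strong premorphism, so the
universal property gives a morphism `FRs.lift` from `FRs S` to the partial action product; it
remains to see that it is bijective. Surjectivity: an idempotent of `S^pr` with set `A` is the meet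
of the `[a][a]⁻¹`, `a ∈ A` (`eq_inf_ran_of`), so all projections are reached, and a projection times
`gen s` gives every pair. Injectivity: generators can be moved past projections (`mul_rplus`,
`exists_mul_eq'`), so each `u` is `u^+ ⌊s⌋` with `u^+` a product of elements `⌊a⌋^+`. The second
coordinate of the image of `u` is `s`. The first is an idempotent `x` of `S^pr`, and `u^+` is the
meet of the `⌊a⌋^+` with `a` in the set of `x` (`exists_isMeet`); hence `x` determines `u^+`. The
crux is `isMeet_mul`: multiplication in `E(S^pr)` translates sets by an idempotent `g`, and below
`⌊g⌋^+` the elements `⌊ga⌋^+` and `⌊a⌋^+` impose the same condition. -/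

namespace RestrictionMonoid

/-! ### Projections of a restriction monoid. -/

section Basic

variable {T : Type v} [RestrictionMonoid T]

theorem rplus_mul_rplus_self (x : T) : rplus x * rplus x = rplus x := by
  rw [← rplus_rplus_mul, rplus_mul_self]

theorem rplus_rplus (x : T) : rplus (rplus x) = rplus x := by
  rw [← rstar_rplus x, rplus_rstar]

theorem rstar_eq_of_rplus_eq {e : T} (he : rplus e = e) : rstar e = e := by
  rw [← he, rstar_rplus]

theorem rplus_one : rplus (1 : T) = 1 := by
  rw [← mul_one (rplus (1 : T)), rplus_mul_self]

theorem rplus_mul_of_rplus_eq {e : T} (he : rplus e = e) (y : T) :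
    rplus (e * y) = e * rplus y := by
  rw [← he, rplus_rplus_mul]

theorem rstar_mul_of_rplus_eq {e : T} (he : rplus e = e) (x : T) :
    rstar (x * e) = rstar x * e := by
  conv_lhs => rw [← rstar_eq_of_rplus_eq he]
  rw [rstar_mul_rstar, rstar_eq_of_rplus_eq he]

theorem mul_comm_of_rplus_eq {e f : T} (he : rplus e = e) (hf : rplus f = f) :
    e * f = f * e := by
  rw [← he, ← hf, rplus_comm]

theorem rplus_mul_eq {e f : T} (he : rplus e = e) (hf : rplus f = f) :
    rplus (e * f) = e * f := by
  rw [rplus_mul_of_rplus_eq he, hf]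

theorem mul_self_of_rplus_eq {e : T} (he : rplus e = e) : e * e = e := by
  rw [← he, rplus_mul_rplus_self]

/-- For projections, `r ≤ e f` if and only if `r ≤ e` and `r ≤ f`. -/
theorem mul_mul_eq_iff {r e f : T} (he : rplus e = e) (hf : rplus f = f) :
    r * (e * f) = r ↔ r * e = r ∧ r * f = r := by
  constructor
  · intro h
    constructor
    · conv_lhs => rw [← h, mul_comm_of_rplus_eq he hf, mul_assoc, mul_assoc,
        mul_self_of_rplus_eq he, ← mul_comm_of_rplus_eq he hf]
      exact h
    · conv_lhs => rw [← h, mul_assoc, mul_assoc, mul_self_of_rplus_eq hf]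
      exact h
  · rintro ⟨h1, h2⟩
    rw [← mul_assoc, h1, h2]

end Basic

end RestrictionMonoid

/-! ### Strong premorphisms and meets of the projections they generate. -/

/-- Strong premorphisms from a monoid to a restriction monoid. -/
structure IsStrongPremorphism {M : Type u} {T : Type v} [Monoid M] [RestrictionMonoid T]
    (θ : M → T) : Prop where
  map_one : θ 1 = 1
  mul_left : ∀ m n : M, θ m * θ n = RestrictionMonoid.rplus (θ m) * θ (m * n)
  mul_right : ∀ m n : M, θ m * θ n = θ (m * n) * RestrictionMonoid.rstar (θ n)

namespace IsStrongPremorphism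

open RestrictionMonoid

section Projections

variable {X : Type u} {T : Type v} [RestrictionMonoid T] {θ : X → T}

/-- The submonoid of projections generated by the elements `(θ m)^+`. -/
def projections (θ : X → T) : Submonoid T :=
  Submonoid.closure (Set.range fun m => rplus (θ m))

theorem rplus_mem_projections (m : X) : rplus (θ m) ∈ projections θ :=
  Submonoid.subset_closure ⟨m, rfl⟩

theorem rplus_eq_of_mem {q : T} (hq : q ∈ projections θ) : rplus q = q := by
  induction hq using Submonoid.closure_induction with
  | mem x hx => obtain ⟨m, rfl⟩ := hx; exact rplus_rplus _
  | one => exact rplus_one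
  | mul x y _ _ hx hy => exact rplus_mul_eq hx hy

/-- `q` is the greatest lower bound, among the projections, of the elements `(θ a)^+` with
`a ∈ A`. -/
def IsMeet (θ : X → T) (A : Set X) (q : T) : Prop :=
  rplus q = q ∧ ∀ r : T, rplus r = r → (r * q = r ↔ ∀ a ∈ A, r * rplus (θ a) = r)

/-- Each of the two meets lies below the other. This is what recovers a projection of `FRs S` from
an idempotent of `S^pr`. -/
theorem IsMeet.unique {A : Set X} {q q' : T} (h : IsMeet θ A q) (h' : IsMeet θ A q') :
    q = q' := by
  have h1 : q * q' = q := (h'.2 q h.1).2 ((h.2 q h.1).1 (mul_self_of_rplus_eq h.1))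
  have h2 : q' * q = q' := (h.2 q' h'.1).2 ((h'.2 q' h'.1).1 (mul_self_of_rplus_eq h'.1))
  rw [← h1, mul_comm_of_rplus_eq h.1 h'.1, h2]

end Projections

section Monoid

variable {M : Type u} {T : Type v} [Monoid M] [RestrictionMonoid T] {θ : M → T}

/-- The two strong laws evaluate `θ g * θ s` in two ways; the right one gives `θ s * rstar (θ s)`,
which is `θ s`. -/
theorem rplus_mul (h : IsStrongPremorphism θ) {g s : M} (hg : g * s = s) :
    rplus (θ g) * θ s = θ s := by
  have h1 := h.mul_left g s
  rw [h.mul_right, hg, mul_rstar_self] at h1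
  exact h1.symm

theorem mul_rstar (h : IsStrongPremorphism θ) {g s : M} (hg : s * g = s) :
    θ s * rstar (θ g) = θ s := by
  have h1 := h.mul_right s g
  rw [h.mul_left, hg, rplus_mul_self] at h1
  exact h1.symm

theorem rplus_le (h : IsStrongPremorphism θ) {g s : M} (hg : g * s = s) :
    rplus (θ s) * rplus (θ g) = rplus (θ s) := by
  rw [rplus_comm, ← rplus_rplus_mul, h.rplus_mul hg]

theorem rplus_map_mul (h : IsStrongPremorphism θ) (s t : M) :
    rplus (θ s * θ t) = rplus (θ s) * rplus (θ (s * t)) := by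
  rw [h.mul_left, rplus_rplus_mul]

/-- Passing a projection through `θ s` translates its index by `s`: the factor `rplus (θ s)` that
the strong law produces is absorbed by `θ s`. -/
theorem mul_rplus (h : IsStrongPremorphism θ) (s t : M) :
    θ s * rplus (θ t) = rplus (θ (s * t)) * θ s := by
  rw [RestrictionMonoid.mul_rplus, h.rplus_map_mul, rplus_comm, mul_assoc, rplus_mul_self]

theorem rstar_map_mul (h : IsStrongPremorphism θ) (s t : M) :
    rstar (θ s * θ t) = rstar (θ (s * t)) * rstar (θ t) := by
  rw [h.mul_right, rstar_mul_rstar]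

theorem rstar_mul (h : IsStrongPremorphism θ) (s t : M) :
    rstar (θ s) * θ t = θ t * rstar (θ (s * t)) := by
  rw [RestrictionMonoid.rstar_mul, h.rstar_map_mul, rstar_comm, ← mul_assoc, mul_rstar_self]

theorem exists_mul_eq (h : IsStrongPremorphism θ) (s : M) {q : T} (hq : q ∈ projections θ) :
    ∃ r ∈ projections θ, θ s * q = r * θ s := by
  induction hq using Submonoid.closure_induction with
  | mem x hx =>
    obtain ⟨m, rfl⟩ := hx
    exact ⟨_, rplus_mem_projections _, h.mul_rplus s m⟩
  | one => exact ⟨1, one_mem _, by rw [mul_one, one_mul]⟩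
  | mul x y _ _ hx hy =>
    obtain ⟨r, hr, h1⟩ := hx
    obtain ⟨r', hr', h2⟩ := hy
    exact ⟨r * r', mul_mem hr hr', by rw [← mul_assoc, h1, mul_assoc, h2, mul_assoc]⟩

end Monoid

section InverseMonoid

open InverseMonoid

variable {S : Type u} {T : Type v} [InverseMonoid S] [RestrictionMonoid T] {θ : S → T}

/-- `θ s` absorbs `rplus (θ s⁻¹)` on the right and `θ s⁻¹` absorbs `rstar (θ s)` on the left, so
each projection is below the other. Thus the elements `(θ m)^+` already account for all `(θ m)^*`.
-/
theorem rstar_eq (h : IsStrongPremorphism θ) (s : S) : rstar (θ s) = rplus (θ s⁻¹) := by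
  have h1 : θ s * rplus (θ s⁻¹) = θ s := by
    rw [h.mul_rplus, h.rplus_mul (mul_inv_mul_self s)]
  have h2 : rstar (θ s) * θ s⁻¹ = θ s⁻¹ := by
    rw [h.rstar_mul, h.mul_rstar]
    rw [← mul_assoc, inv_mul_inv_self]
  have h3 := rstar_mul_of_rplus_eq (rplus_rplus (θ s⁻¹)) (θ s)
  have h4 := rplus_mul_of_rplus_eq (rplus_rstar (θ s)) (θ s⁻¹)
  rw [h1] at h3
  rw [h2] at h4
  rw [h3, ← h4]

/-- The action of `θ f` on projections is trivial for idempotent `f`. -/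
theorem rplus_mul_rplus_of_idem (h : IsStrongPremorphism θ) {f : S} (hf : f * f = f) (a : S) :
    rplus (θ f) * rplus (θ (f * a)) = rplus (θ f) * rplus (θ a) := by
  have hs : rstar (θ f) = rplus (θ f) := by rw [h.rstar_eq, inv_eq_of_idem hf]
  -- Both sides equal `rplus (θ (f * a)) * θ f`; applying `rstar` then replaces the factor `θ f` by
  -- its projection.
  have h1 : θ f * rplus (θ (f * a)) = θ f * rplus (θ a) := by
    rw [h.mul_rplus, h.mul_rplus, ← mul_assoc, hf]
  have h2 := congrArg rstar h1
  rwa [rstar_mul_of_rplus_eq (rplus_rplus _), rstar_mul_of_rplus_eq (rplus_rplus _), hs] at h2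

theorem exists_mul_eq' (h : IsStrongPremorphism θ) (s : S) {q : T} (hq : q ∈ projections θ) :
    ∃ r ∈ projections θ, q * θ s = θ s * r := by
  induction hq using Submonoid.closure_induction with
  | mem x hx =>
    obtain ⟨m, rfl⟩ := hx
    -- Write `rplus (θ m)` as `rstar (θ m⁻¹)`, move it past `θ s` by `rstar_mul`, and turn the
    -- resulting star back into a plus.
    refine ⟨rplus (θ (m⁻¹ * s)⁻¹), rplus_mem_projections _, ?_⟩
    have h1 := h.rstar_mul m⁻¹ s
    rwa [h.rstar_eq, h.rstar_eq, inv_inv'] at h1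
  | one => exact ⟨1, one_mem _, by rw [mul_one, one_mul]⟩
  | mul x y _ _ hx hy =>
    obtain ⟨r, hr, h1⟩ := hx
    obtain ⟨r', hr', h2⟩ := hy
    exact ⟨r * r', mul_mem hr hr', by rw [mul_assoc, h2, ← mul_assoc, h1, mul_assoc]⟩

/-- Multiplying `a` by an idempotent `g` does not change `(θ a)^+` below `(θ g)^+`. -/
theorem mul_rplus_eq_iff (h : IsStrongPremorphism θ) {g : S} (hg : g * g = g) {r : T}
    (hr : r * rplus (θ g) = r) (a : S) :
    r * rplus (θ (g * a)) = r ↔ r * rplus (θ a) = r := by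
  conv_lhs => rw [← hr, mul_assoc, h.rplus_mul_rplus_of_idem hg, ← mul_assoc, hr]

/-- With `g` the second component of `x ⊓ y`, its set is `g A ∪ g B`, where `A` and `B` are the sets
of `x` and `y`. For a projection below `rplus (θ g)`, `mul_rplus_eq_iff` removes the translation by
`g`. -/
theorem isMeet_mul (h : IsStrongPremorphism θ) {x y : Idem (PrefixExpansion S)} {q r : T}
    (hq : IsMeet θ x.1.set q) (hr : IsMeet θ y.1.set r) :
    IsMeet θ (x ⊓ y).1.set (q * r) := by
  refine ⟨rplus_mul_eq hq.1 hr.1, fun p hp => ?_⟩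
  have he : x.1.elt * x.1.elt = x.1.elt := congrArg PrefixExpansion.elt x.2
  have hf : y.1.elt * y.1.elt = y.1.elt := congrArg PrefixExpansion.elt y.2
  have hg : (x ⊓ y).1.elt * (x ⊓ y).1.elt = (x ⊓ y).1.elt :=
    congrArg PrefixExpansion.elt (x ⊓ y).2
  have hef : (x ⊓ y).1.elt = x.1.elt * y.1.elt := rfl
  have hyelt : ∀ b ∈ y.1.set, y.1.elt * b = b := fun b hb => by
    have := PrefixExpansion.ran_elt_mul y.1 hb
    rwa [inv_eq_of_idem hf, hf] at this
  rw [mul_mul_eq_iff hq.1 hr.1, hq.2 p hp, hr.2 p hp]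
  have hmem : ∀ c, c ∈ (x ⊓ y).1.set ↔
      (∃ a ∈ x.1.set, (x ⊓ y).1.elt * a = c) ∨ ∃ b ∈ y.1.set, (x ⊓ y).1.elt * b = c := by
    intro c
    change c ∈ (x.1 * y.1).set ↔ _
    rw [PrefixExpansion.mem_mul]
    refine or_congr (exists_congr fun a => and_congr_right fun _ => ?_)
      (exists_congr fun b => and_congr_right fun hb => ?_)
    · rw [← hef, inv_eq_of_idem hg, hg]
    · rw [hef, mul_assoc, hyelt b hb]
  constructor
  · rintro ⟨hA, hB⟩ c hc
    -- The components `e` and `f` of `x` and `y` lie in their own sets, so `p` is below both `(θ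
    -- e)^+` and `(θ f)^+`, and therefore below `(θ (ef))^+`.
    have h1 : p * rplus (θ (x ⊓ y).1.elt) = p := by
      rw [hef]
      exact (h.mul_rplus_eq_iff he (hA _ x.1.elt_mem) _).2 (hB _ y.1.elt_mem)
    rcases (hmem c).1 hc with ⟨a, ha, rfl⟩ | ⟨b, hb, rfl⟩
    · exact (h.mul_rplus_eq_iff hg h1 a).2 (hA a ha)
    · exact (h.mul_rplus_eq_iff hg h1 b).2 (hB b hb)
  · intro hC
    have h1 : p * rplus (θ (x ⊓ y).1.elt) = p := hC _ (x ⊓ y).1.elt_mem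
    exact ⟨fun a ha => (h.mul_rplus_eq_iff hg h1 a).1 (hC _ ((hmem _).2 (Or.inl ⟨a, ha, rfl⟩))),
      fun b hb => (h.mul_rplus_eq_iff hg h1 b).1 (hC _ ((hmem _).2 (Or.inr ⟨b, hb, rfl⟩)))⟩

/-- The set is `{a a⁻¹, a}`, and the condition at `a a⁻¹` follows from the one at `a` by `rplus_le`.
-/
theorem isMeet_ran (h : IsStrongPremorphism θ) (a : S) :
    IsMeet θ (ran (PrefixExpansion.of a)).1.set (rplus (θ a)) := by
  refine ⟨rplus_rplus _, fun r _ => ?_⟩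
  constructor
  · intro hr c hc
    rcases PrefixExpansion.mem_mul_inv.1 hc with rfl | rfl
    · rw [← hr, mul_assoc, h.rplus_le (mul_inv_mul_self a)]
    · exact hr
  · exact fun hr => hr a (PrefixExpansion.mem_mul_inv.2 (Or.inr rfl))

theorem isMeet_top (h : IsStrongPremorphism θ) :
    IsMeet θ (⊤ : Idem (PrefixExpansion S)).1.set 1 := by
  refine ⟨rplus_one, fun r _ => ⟨fun _ c hc => ?_, fun _ => mul_one r⟩⟩
  rw [PrefixExpansion.mem_one.1 hc, h.map_one, rplus_one, mul_one]

end InverseMonoid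

end IsStrongPremorphism

/-! ### Universal property and normal form of `FRs`. -/

namespace RTerm

variable {X : Type u} {T : Type v} [RestrictionMonoid T]

/-- Evaluation of terms in a restriction monoid. -/
def eval (θ : X → T) : RTerm X → T
  | gen x => θ x
  | one => 1
  | mul a b => eval θ a * eval θ b
  | star a => RestrictionMonoid.rstar (eval θ a)
  | plus a => RestrictionMonoid.rplus (eval θ a)

theorem Cong.eval_eq {R : RTerm X → RTerm X → Prop} {θ : X → T}
    (hR : ∀ a b, R a b → a.eval θ = b.eval θ) {a b : RTerm X} (h : Cong R a b) :
    a.eval θ = b.eval θ := by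
  induction h with
  | rel h => exact hR _ _ h
  | refl => rfl
  | symm _ ih => exact ih.symm
  | trans _ _ ih ih' => exact ih.trans ih'
  | mul_congr _ _ ih ih' => exact congrArg₂ (· * ·) ih ih'
  | star_congr _ ih => exact congrArg RestrictionMonoid.rstar ih
  | plus_congr _ ih => exact congrArg RestrictionMonoid.rplus ih
  | mul_assoc => exact _root_.mul_assoc _ _ _
  | one_mul => exact _root_.one_mul _
  | mul_one => exact _root_.mul_one _
  | mul_star_self => exact RestrictionMonoid.mul_rstar_self _
  | star_comm => exact RestrictionMonoid.rstar_comm _ _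
  | star_mul_star => exact RestrictionMonoid.rstar_mul_rstar _ _
  | star_mul => exact RestrictionMonoid.rstar_mul _ _
  | plus_mul_self => exact RestrictionMonoid.rplus_mul_self _
  | plus_comm => exact RestrictionMonoid.rplus_comm _ _
  | plus_plus_mul => exact RestrictionMonoid.rplus_rplus_mul _ _
  | mul_plus => exact RestrictionMonoid.mul_rplus _ _
  | star_plus => exact RestrictionMonoid.rstar_rplus _
  | plus_star => exact RestrictionMonoid.rplus_rstar _

end RTerm

namespace FRs

open RestrictionMonoid

section Lift

variable {M : Type u} {T : Type v} [Monoid M] [RestrictionMonoid T] {θ : M → T}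

theorem isStrongPremorphism_of : IsStrongPremorphism (of : M → FRs M) where
  map_one := Quotient.sound (.rel .one)
  mul_left m n := Quotient.sound (.rel (.left m n))
  mul_right m n := Quotient.sound (.rel (.right m n))

/-- The universal property of `FR_s(M)`. -/
def lift (h : IsStrongPremorphism θ) : FRs M → T :=
  Quotient.lift (RTerm.eval θ) fun _ _ => RTerm.Cong.eval_eq fun _ _ hab => by
    cases hab with
    | one => exact h.map_one
    | left m n => exact h.mul_left m n
    | right m n => exact h.mul_right m n

theorem lift_mul (h : IsStrongPremorphism θ) (u v : FRs M) :
    lift h (u * v) = lift h u * lift h v := by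
  induction u using Quotient.inductionOn
  induction v using Quotient.inductionOn
  rfl

theorem lift_rstar (h : IsStrongPremorphism θ) (u : FRs M) :
    lift h (rstar u) = rstar (lift h u) := by
  induction u using Quotient.inductionOn
  rfl

theorem lift_rplus (h : IsStrongPremorphism θ) (u : FRs M) :
    lift h (rplus u) = rplus (lift h u) := by
  induction u using Quotient.inductionOn
  rfl

end Lift

open IsStrongPremorphism

variable {S : Type u} [InverseMonoid S]

/-- Every element of `FR_s(S)` has the form `q ⌊s⌋` with `q` a product of elements `⌊a⌋^+`. -/
theorem exists_eq_mul_of (u : FRs S) :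
    ∃ q ∈ projections (of : S → FRs S), ∃ s : S, u = q * of s := by
  have h : IsStrongPremorphism (of : S → FRs S) := isStrongPremorphism_of
  induction u using Quotient.inductionOn with | _ t
  induction t with
  | gen s => exact ⟨1, one_mem _, s, (one_mul (of s)).symm⟩
  | one => exact ⟨1, one_mem _, 1, ((one_mul _).trans h.map_one).symm⟩
  | mul a b iha ihb =>
    obtain ⟨q, hq, s, ha⟩ := iha
    obtain ⟨r, hr, t, hb⟩ := ihb
    obtain ⟨r', hr', e⟩ := h.exists_mul_eq s hr
    -- `q⌊s⌋ r⌊t⌋ = q r' ⌊s⌋⌊t⌋ = q r' ⌊s⌋^+ ⌊st⌋`.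
    refine ⟨q * r' * rplus (of s), mul_mem (mul_mem hq hr') (rplus_mem_projections s),
      s * t, ?_⟩
    change HMul.hMul (α := FRs S) (β := FRs S) (γ := FRs S) (Quotient.mk _ a) (Quotient.mk _ b) = _
    rw [ha, hb, mul_assoc _ (rplus (of s)), ← h.mul_left, mul_assoc q, ← mul_assoc (of s), e]
    simp only [mul_assoc]
  | star a iha =>
    obtain ⟨q, hq, s, ha⟩ := iha
    obtain ⟨r, hr, e⟩ := h.exists_mul_eq' s hq
    -- `(q⌊s⌋)^* = (⌊s⌋r)^* = ⌊s⌋^* r`, and `⌊s⌋^*` is `⌊s⁻¹⌋^+`.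
    refine ⟨rplus (of s⁻¹) * r, mul_mem (rplus_mem_projections _) hr, 1, ?_⟩
    change rstar (S := FRs S) (Quotient.mk _ a) = _
    rw [ha, e, rstar_mul_of_rplus_eq (rplus_eq_of_mem hr), h.rstar_eq, h.map_one, mul_one]
  | plus a iha =>
    obtain ⟨q, hq, s, ha⟩ := iha
    refine ⟨q * rplus (of s), mul_mem hq (rplus_mem_projections s), 1, ?_⟩
    change rplus (S := FRs S) (Quotient.mk _ a) = _
    rw [ha, rplus_mul_of_rplus_eq (rplus_eq_of_mem hq), h.map_one, mul_one]

theorem rplus_mem (u : FRs S) : rplus u ∈ projections (of : S → FRs S) := by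
  obtain ⟨q, hq, s, rfl⟩ := exists_eq_mul_of u
  rw [rplus_mul_of_rplus_eq (rplus_eq_of_mem hq)]
  exact mul_mem hq (rplus_mem_projections s)

/-- Absorbing `⌊s⌋^+` into `q` makes the projection in the normal form depend on `u` alone, as
injectivity requires. -/
theorem exists_eq_rplus_mul_of (u : FRs S) : ∃ s : S, u = rplus u * of s := by
  obtain ⟨q, hq, s, rfl⟩ := exists_eq_mul_of u
  exact ⟨s, by rw [rplus_mul_of_rplus_eq (rplus_eq_of_mem hq), mul_assoc, rplus_mul_self]⟩

end FRs

/-! ### Projections in the partial action product. -/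

namespace PartialActionProduct

variable {T : Type u} {Y : Type v} [Monoid T] [SemilatticeInf Y] [OrderTop Y]
  {D : PartialAction T Y}

theorem rplus_eq (a : PartialActionProduct D) : RestrictionMonoid.rplus a = proj D a.fst := rfl

theorem rstar_eq (a : PartialActionProduct D) : RestrictionMonoid.rstar a = proj D a.pre := rfl

theorem proj_mul_eq {x : Y} {a b : PartialActionProduct D} (h : x = b.fst) (hx : x ≤ a.fst)
    (hs : a.snd = b.snd) : proj D x * a = b :=
  PartialActionProduct.ext (by rw [proj_mul, ← h, inf_eq_left.2 hx])
    ((one_mul _).trans hs)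

end PartialActionProduct

/-! ### The prefix expansion, its idempotents, and the bijectivity of the lift. -/

namespace PrefixExpansion

open InverseMonoid PartialActionProduct RestrictionMonoid

variable {S : Type u} [InverseMonoid S]

/-- Both sides have the set `{h, h s, s t}` with `h = (st)(st)⁻¹`, because `s (t t⁻¹) = h s` and `h
(s s⁻¹) = h`. -/
theorem of_mul_of (s t : S) : of s * of t = of s * (of s)⁻¹ * of (s * t) := by
  have h : s * s⁻¹ * (s * t) = s * t := by rw [← mul_assoc, mul_inv_mul_self]
  refine ext' (fun c => ?_) h.symm
  rw [mem_mul, mem_mul]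
  simp only [mem_mul_inv, mul_inv_elt]
  change (∃ a ∈ (of s).set, s * t * (s * t)⁻¹ * a = c) ∨ (∃ b ∈ ({t * t⁻¹, t} : Set S), s * b = c) ↔
    (∃ a ∈ (of s).set, s * s⁻¹ * (s * t) * (s * s⁻¹ * (s * t))⁻¹ * a = c) ∨
      ∃ b ∈ ({s * t * (s * t)⁻¹, s * t} : Set S), s * s⁻¹ * b = c
  rw [h]
  have h1 : s * s⁻¹ * (s * t * (s * t)⁻¹) = s * t * (s * t)⁻¹ * (s * s⁻¹) := mul_inv_comm _ _
  constructor
  · rintro (ha | ⟨b, rfl | rfl, rfl⟩)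
    · exact Or.inl ha
    · exact Or.inl ⟨s, Or.inr rfl, ran_mul_mul s t⟩
    · exact Or.inr ⟨_, Or.inr rfl, h⟩
  · rintro (ha | ⟨b, rfl | rfl, rfl⟩)
    · exact Or.inl ha
    · exact Or.inl ⟨s * s⁻¹, Or.inl rfl, h1.symm⟩
    · exact Or.inr ⟨t, Or.inr rfl, h.symm⟩

theorem inv_of (s : S) : (of s)⁻¹ = of s⁻¹ := by
  refine ext' (fun c => ?_) rfl
  rw [mem_inv]
  change (∃ a ∈ ({s * s⁻¹, s} : Set S), s⁻¹ * a = c) ↔ c ∈ ({s⁻¹ * s⁻¹⁻¹, s⁻¹} : Set S)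
  simp only [Set.mem_insert_iff, Set.mem_singleton_iff, exists_eq_or_imp, exists_eq_left, inv_inv',
    ← mul_assoc, inv_mul_inv_self]
  tauto

theorem of_mul_of' (s t : S) : of s * of t = of (s * t) * ((of t)⁻¹ * of t) := by
  have h := congrArg (·⁻¹) (of_mul_of t⁻¹ s⁻¹)
  simp only [mul_inv_rev', inv_of, inv_inv'] at h
  rw [h, inv_of]

/-- Once the second components agree, the set of `y x` is that of `y` together with a translate of
that of `x`, so `y x = y` says that the translate adds nothing. -/
theorem le_iff {x y : Idem (PrefixExpansion S)} :
    y ≤ x ↔ y.1.elt * x.1.elt = y.1.elt ∧ ∀ a ∈ x.1.set, y.1.elt * a ∈ y.1.set := by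
  rw [idem_le_iff]
  constructor
  · intro h
    refine ⟨congrArg elt h, fun a ha => ?_⟩
    rw [← h]
    have h1 : (y.1 * x.1).elt = y.1.elt := by rw [h]
    rw [h1]
    exact Or.inr ⟨a, ha, rfl⟩
  · rintro ⟨h, hA⟩
    refine ext' (fun c => ?_) h
    rw [mem_mul, h]
    constructor
    · rintro (⟨a, ha, rfl⟩ | ⟨a, ha, rfl⟩)
      · rwa [ran_elt_mul _ ha]
      · exact hA a ha
    · exact fun hc => Or.inl ⟨c, hc, ran_elt_mul _ hc⟩

theorem le_ran_of_iff {y : Idem (PrefixExpansion S)} {a : S} :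
    y ≤ ran (of a) ↔ y.1.elt * (a * a⁻¹) = y.1.elt ∧ y.1.elt * a ∈ y.1.set := by
  rw [le_iff]
  refine and_congr_right fun h => ⟨fun hA => hA a (mem_mul_inv.2 (Or.inr rfl)), fun ha c hc => ?_⟩
  rcases mem_mul_inv.1 hc with rfl | rfl
  · have h' : y.1.elt * (a * a⁻¹) = y.1.elt := h
    rw [h']
    exact y.1.elt_mem
  · exact ha

/-- This shows that the `[a][a]⁻¹` generate the semilattice `E(S^pr)`; finiteness of the set makes
the meet available. -/
theorem eq_inf_ran_of (x : Idem (PrefixExpansion S)) :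
    x = x.1.finite.toFinset.inf fun a => ran (of a) := by
  have he : x.1.elt * x.1.elt = x.1.elt := congrArg elt x.2
  have hran : x.1.elt * x.1.elt⁻¹ = x.1.elt := by rw [inv_eq_of_idem he, he]
  refine le_antisymm (Finset.le_inf fun a ha => ?_) ?_
  · rw [Set.Finite.mem_toFinset] at ha
    have h := ran_elt_mul _ ha
    rw [hran] at h
    rw [le_ran_of_iff, x.1.ran_eq a ha, hran, h]
    exact ⟨he, ha⟩
  · have h : ∀ a ∈ x.1.set, x.1.finite.toFinset.inf (fun a => ran (of a)) ≤ ran (of a) :=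
      fun a ha => Finset.inf_le ((Set.Finite.mem_toFinset _).2 ha)
    rw [le_iff]
    refine ⟨?_, fun a ha => (le_ran_of_iff.1 (h a ha)).2⟩
    -- The second component of `x` is idempotent and lies in its own set, so it is one of the
    -- indices `a` and there `a a⁻¹ = a`.
    have := (le_ran_of_iff.1 (h _ x.1.elt_mem)).1
    rwa [hran] at this

/-- The element `([s][s]⁻¹, s)` of the partial action product. -/
noncomputable def gen (s : S) : PartialActionProduct (prefixAction S) :=
  ⟨ran (of s), s, munn_symm_isSome.2 le_rfl⟩

theorem gen_pre (s : S) : (gen s).pre = dom (of s) := by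
  refine pre_eq _ (mem_munn.2 ⟨le_rfl, Subtype.ext ?_⟩)
  change of s * ((of s)⁻¹ * of s) * (of s)⁻¹ = of s * (of s)⁻¹
  rw [← mul_assoc, mul_inv_mul_self]

/-- Conjugating `a a⁻¹` by `[s]` gives the range of `[s] a`. First coordinates of products thus
become ranges in `S^pr`, which reduces the strong laws for `gen` to `of_mul_of` and `of_mul_of'`. -/
theorem gen_act (s : S) {x : Idem (PrefixExpansion S)} {a : PrefixExpansion S}
    (h : x.1 = a * a⁻¹) : (gen s).act x = ran (of s * a) := by
  refine act_eq _ (mem_munn.2 ?_)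
  rw [gen_pre]
  refine ⟨inf_le_left, Subtype.ext ?_⟩
  change of s * ((of s)⁻¹ * of s * x.1) * (of s)⁻¹ = of s * a * (of s * a)⁻¹
  rw [h, ← mul_assoc (of s), ← mul_assoc (of s) (of s)⁻¹, mul_inv_mul_self, mul_inv_rev']
  simp only [mul_assoc]

theorem isStrongPremorphism_gen :
    IsStrongPremorphism (gen : S → PartialActionProduct (prefixAction S)) where
  map_one := by
    refine PartialActionProduct.ext (Subtype.ext ?_) rfl
    change of 1 * (of (1 : S))⁻¹ = 1
    rw [isPremorphism_of.map_one, inv_eq_of_idem (one_mul 1), one_mul]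
  mul_left s t := by
    refine PartialActionProduct.ext ?_ (one_mul _).symm
    rw [mul_fst, rplus_eq, proj_mul, gen_act s rfl, of_mul_of]
    exact Subtype.ext (ran_mul_of_idem (mul_inv_self_idem (of s)) _)
  mul_right s t := by
    refine PartialActionProduct.ext ?_ (mul_one _).symm
    rw [mul_fst, mul_fst, rstar_eq, gen_act s rfl, of_mul_of', gen_pre]
    -- The idempotent `[t]⁻¹[t]` serves as its own `a`, since `a a⁻¹ = a` for idempotent `a`.
    refine (gen_act (s * t) ?_).symm
    rw [inv_eq_of_idem (inv_mul_self_idem _), inv_mul_self_idem]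
    rfl

/-- The same `x` is the first coordinate of the image of `q` and, through its set, characterises `q`
as a meet. Hence the lift is injective on these projections. -/
theorem exists_isMeet {q : FRs S}
    (hq : q ∈ IsStrongPremorphism.projections (FRs.of : S → FRs S)) :
    ∃ x : Idem (PrefixExpansion S), IsStrongPremorphism.IsMeet FRs.of x.1.set q ∧
      FRs.lift isStrongPremorphism_gen q = proj _ x := by
  have h : IsStrongPremorphism (FRs.of : S → FRs S) := FRs.isStrongPremorphism_of
  induction hq using Submonoid.closure_induction with
  | mem x hx =>
    obtain ⟨a, rfl⟩ := hx
    exact ⟨ran (of a), h.isMeet_ran a, FRs.lift_rplus _ _⟩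
  | one => exact ⟨⊤, h.isMeet_top, rfl⟩
  | mul q r _ _ hq hr =>
    obtain ⟨x, hx, hx'⟩ := hq
    obtain ⟨y, hy, hy'⟩ := hr
    exact ⟨x ⊓ y, h.isMeet_mul hx hy, by rw [FRs.lift_mul, hx', hy', proj_mul_proj]⟩

theorem lift_gen_injective : Function.Injective (FRs.lift (isStrongPremorphism_gen (S := S))) := by
  intro u v huv
  have hp : rplus u = rplus v := by
    obtain ⟨x, hx, hx'⟩ := exists_isMeet (FRs.rplus_mem u)
    obtain ⟨y, hy, hy'⟩ := exists_isMeet (FRs.rplus_mem v)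
    rw [FRs.lift_rplus, huv, ← FRs.lift_rplus, hy'] at hx'
    have hyx : y = x := congrArg PartialActionProduct.fst hx'
    rw [hyx] at hy
    exact hx.unique hy
  -- The image of `rplus u` is a projection, with second coordinate `1`, so only `⌊s⌋` contributes.
  have hsnd : ∀ (u : FRs S) (s : S), u = rplus u * FRs.of s →
      (FRs.lift isStrongPremorphism_gen u).snd = s := by
    intro u s hu
    rw [hu, FRs.lift_mul, FRs.lift_rplus]
    exact one_mul s
  obtain ⟨s, hs⟩ := FRs.exists_eq_rplus_mul_of u
  obtain ⟨t, ht⟩ := FRs.exists_eq_rplus_mul_of v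
  have hst : s = t := by rw [← hsnd u s hs, ← hsnd v t ht, huv]
  rw [hs, ht, hp, hst]

theorem lift_gen_surjective :
    Function.Surjective (FRs.lift (isStrongPremorphism_gen (S := S))) := by
  have hproj : ∀ x : Idem (PrefixExpansion S),
      ∃ u : FRs S, FRs.lift isStrongPremorphism_gen u = proj _ x := by
    intro x
    rw [eq_inf_ran_of x]
    refine Finset.inf_induction (p := fun x => ∃ u : FRs S,
      FRs.lift isStrongPremorphism_gen u = proj _ x) ⟨1, rfl⟩ ?_ fun a _ =>
        ⟨rplus (FRs.of a), FRs.lift_rplus _ _⟩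
    rintro x ⟨u, hu⟩ y ⟨v, hv⟩
    exact ⟨u * v, by rw [FRs.lift_mul, hu, hv, proj_mul_proj]⟩
  intro a
  obtain ⟨u, hu⟩ := hproj a.fst
  refine ⟨u * FRs.of a.snd, ?_⟩
  rw [FRs.lift_mul, hu]
  -- Membership of `(e, s)` in the product means `e ≤ [s][s]⁻¹`, so cutting `gen s` down by `e`
  -- leaves exactly `(e, s)`.
  exact proj_mul_eq rfl (munn_symm_isSome.1 a.mem_ran) rfl

end PrefixExpansion

theorem mainTheorem7 {S : Type u} [InverseMonoid S] :
    ∃ Ψ : RestrictionMonoid.Iso (FRs S) (PartialActionProduct (prefixAction S)),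
      ∀ s : S, (Ψ.toMulEquiv (FRs.of s)).fst = InverseMonoid.ran (PrefixExpansion.of s) ∧
        (Ψ.toMulEquiv (FRs.of s)).snd = s := by
  refine ⟨{ toMulEquiv := MulEquiv.ofBijective
              (⟨FRs.lift PrefixExpansion.isStrongPremorphism_gen, FRs.lift_mul _⟩ :
                FRs S →ₙ* PartialActionProduct (prefixAction S))
              ⟨PrefixExpansion.lift_gen_injective, PrefixExpansion.lift_gen_surjective⟩
            map_rstar := FRs.lift_rstar PrefixExpansion.isStrongPremorphism_gen
            map_rplus := FRs.lift_rplus PrefixExpansion.isStrongPremorphism_gen }, fun s => ⟨rfl, rfl⟩⟩
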